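/- **Setting.** Let $A=(A_i)_{i\in I}$ be a finite or countably infinite family of bounded operators on a complex Hilbert space $H$ which is a row contraction, i.e. $A:(x_i)_i\mapsto\sum_i A_ix_i$ defines a contraction from $\bigoplus_{i\in I}H$ to $H$. For a word $\alpha=\alpha_1\cdots\alpha_m$ in the letters $I$ put $A_\alpha=A_{\alpha_1}\cdots A_{\alpha_m}$ ($A_\emptyset=\mathrm{id}$). Assume that $A$ is completely non-coisometric: if $z\in H$ satisfies $\sum_{|\alpha|=n}\|A_\alpha^*z\|^2=\|z\|^2$ for all $n\in\mathbb N$, then $z=0$. Let $\Gamma$ be the full Fock space over $\ell^2(I)$, with orthonormal basis $(e_\alpha)$ indexed by the words $\alpha$, and let $L_i$ be the creation operators, $L_ie_\alpha=e_{i\alpha}$. A contractive multi-analytic operator is a contraction $M:\Gamma\otimes\mathcal D\to\Gamma\otimes\mathcal L$ ($\mathcal D,\mathcal L$ Hilbert spaces) with $M(L_i\otimes I)=(L_i\otimes I)M$ for all $i$. Its symbol is $\Theta:\mathcal D\to\Gamma\otimes\mathcal L$, $\Theta(\delta)=M(e_\emptyset\otimes\delta)$. The symbol has no constant directions if $\Theta(\delta)\in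 e_\emptyset\otimes\mathcal L$ only for $\delta=0$. **Characteristic function.** Let $D_A=(I-A^*A)^{1/2}$ on $\bigoplus_{i}H$ and $D_{*,A}=(I-AA^*)^{1/2}$ on $H$, and let $\mathcal D_A$, $\mathcal D_{*,A}$ be the closures of their ranges. The minimal isometric dilation $V^A=(V^A_j)_j$ of $A$ acts on $H\oplus(\Gamma\otimes\mathcal D_A)$ by $$V^A_j(h\oplus\xi)=A_jh\oplus\bigl(e_\emptyset\otimes D_A(\delta_{ij}h)_i+(L_j\otimes I)\xi\bigr).$$ The space $\mathcal D_{*,A}$ is identified with $\mathcal L_{*,A}=\bigcap_j\ker(V^A_j)^*$ through the unitary $D_{*,A}h\mapsto(I-\sum_iV^A_iA_i^*)h$, and the row shift part $\bigoplus_\alpha V^A_\alpha\mathcal L_{*,A}$ is identified with $\Gamma\otimes\mathcal D_{*,A}$ through $V^A_\alpha d\leftrightarrow e_\alpha\otimes d$. The characteristic function of $A$ is the contractive multi-analytic operator $M_{\Theta_A}:\Gamma\otimes\mathcal D_A\to\Gamma\otimes\mathcal D_{*,A}$, with symbol $\Theta_A$, given by the orthogonal projection onto the row shift part restricted to $\Gamma\otimes\mathcal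 D_A$. **Functional model.** For $M=M_{\Theta_A}$ and $\Delta=(I-M^*M)^{1/2}$ let $$\mathcal H_\Theta=(\Gamma\otimes\mathcal D_{*,A})\oplus\overline{\Delta(\Gamma\otimes\mathcal D_A)},\qquad V_j(\eta\oplus\Delta\xi)=(L_j\otimes I)\eta\oplus\Delta(L_j\otimes I)\xi,$$ let $\mathcal H_A$ be the orthogonal complement in $\mathcal H_\Theta$ of $\{M\xi\oplus\Delta\xi:\xi\in\Gamma\otimes\mathcal D_A\}$, and let $\tilde A_j=P_{\mathcal H_A}V_j|_{\mathcal H_A}$. **Corollary 4.4.** Let $A$ be a completely non-coisometric row contraction. Then: 1. The symbol $\Theta_A$ has no constant directions. 2. The symbol $\Theta_A$ is injective. 3. The family $V=(V_j)_j$ provided by the functional model is a minimal isometric dilation of $\tilde A=(\tilde A_j)_j$: the $V_j$ are isometries with mutually orthogonal ranges, $\tilde A_\alpha=P_{\mathcal H_A}V_\alpha|_{\mathcal H_A}$ for all words $\alpha$, and the only closed subspace of $\mathcal H_\Theta$ that contains $\mathcal H_A$ and is invariant under all $V_j$ is $\mathcal H_\Theta$ itself. 4. The family $\tilde A$ is unitarily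 equivalent to $A$, so that $V$ is, up to this equivalence, a minimal isometric dilation of $A$: there is a unitary $U:H\to\mathcal H_A$ with $UA_j=\tilde A_jU$ for all $j$. -/

import Mathlib

open scoped InnerProductSpace

noncomputable section

namespace RowModel

set_option linter.unusedSectionVars false

attribute [local instance 2000] InnerProductSpace.toInner

/-! ### Hilbert sums and the full Fock space -/

section Hilbert

variable {ι : Type*} {E : Type*} [NormedAddCommGroup E] [InnerProductSpace ℂ E]

/-- The Hilbert space direct sum of copies of `E`, one for each `i : ι`. -/
def L2 (ι : Type*) (E : Type*) [NormedAddCommGroup E] [InnerProductSpace ℂ E] : Type _ :=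
  lp (fun _ : ι => E) 2

instance : NormedAddCommGroup (L2 ι E) :=
  inferInstanceAs (NormedAddCommGroup (lp (fun _ : ι => E) 2))

instance : InnerProductSpace ℂ (L2 ι E) :=
  inferInstanceAs (InnerProductSpace ℂ (lp (fun _ : ι => E) 2))

instance [CompleteSpace E] : CompleteSpace (L2 ι E) :=
  inferInstanceAs (CompleteSpace (lp (fun _ : ι => E) 2))

/-- The components of a vector of the direct sum. -/
def L2.coord (f : L2 ι E) (i : ι) : E := f.1 i

instance : CoeFun (L2 ι E) (fun _ => ι → E) where
  coe := L2.coord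

@[ext]
theorem L2.ext {f g : L2 ι E} (h : ∀ i, f i = g i) : f = g :=
  Subtype.ext (funext h)

theorem L2.add_apply (f g : L2 ι E) (i : ι) : (f + g) i = f i + g i := rfl

theorem L2.smul_apply (c : ℂ) (f : L2 ι E) (i : ι) : (c • f) i = c • f i := rfl

/-- The Hilbert space tensor product `Γ ⊗ E` of the full Fock space `Γ` over `ℓ²(ι)` with `E`.
The vectors `e_α`, `α` a word in the letters `ι`, form an orthonormal basis of `Γ`, so `Γ ⊗ E`
is the space of square summable families `(ξ_α)` in `E`, i.e. `ξ = ∑ e_α ⊗ ξ_α`. -/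
abbrev Fock (ι : Type*) (E : Type*) [NormedAddCommGroup E] [InnerProductSpace ℂ E] : Type _ :=
  L2 (List ι) E

open Classical in
/-- The embedding of `E` as the `i`-th summand of `L2 ι E`. For the Fock space,
`single α x` is `e_α ⊗ x`. -/
def single (i : ι) : E →ₗᵢ[ℂ] L2 ι E where
  toFun x := (lp.single (E := fun _ : ι => E) 2 i x : lp (fun _ : ι => E) 2)
  map_add' x y := lp.single_add (E := fun _ : ι => E) 2 i x y
  map_smul' c x := lp.single_smul (E := fun _ : ι => E) (𝕜 := ℂ) 2 i c x
  norm_map' x := lp.norm_single (E := fun _ : ι => E) (by norm_num) i x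

theorem single_eq [inst : DecidableEq ι] (i : ι) (x : E) :
    (single i x : L2 ι E) = (lp.single (E := fun _ : ι => E) 2 i x : lp (fun _ : ι => E) 2) := by
  obtain rfl : inst = fun a b => Classical.propDecidable (a = b) := Subsingleton.elim _ _
  rfl

theorem inner_single_left (i : ι) (a : E) (f : L2 ι E) : ⟪single i a, f⟫_ℂ = ⟪a, f i⟫_ℂ := by
  classical
  rw [single_eq]
  exact lp.inner_single_left (𝕜 := ℂ) (G := fun _ : ι => E) i a f

theorem inner_single_right (i : ι) (a : E) (f : L2 ι E) : ⟪f, single i a⟫_ℂ = ⟪f i, a⟫_ℂ := by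
  rw [← inner_conj_symm, inner_single_left, inner_conj_symm]

theorem inner_single_single_of_ne {i j : ι} (h : i ≠ j) (x y : E) :
    ⟪(single i x : L2 ι E), single j y⟫_ℂ = 0 := by
  classical
  rw [inner_single_left]
  have : (single j y : L2 ι E) i = 0 := lp.single_apply_ne (E := fun _ : ι => E) 2 j y h
  rw [this, inner_zero_right]

theorem norm_sq_eq (f : L2 ι E) : HasSum (fun i => ‖f i‖ ^ 2) (‖f‖ ^ 2) := by
  have := lp.hasSum_norm (E := fun _ : ι => E) (p := 2) (by norm_num) f
  simp only [ENNReal.toReal_ofNat, Real.rpow_ofNat] at this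
  exact this

theorem inner_eq_tsum (f g : L2 ι E) : ⟪f, g⟫_ℂ = ∑' i, ⟪f i, g i⟫_ℂ := rfl

/-- The left creation operator `L_j ⊗ I` on `Γ ⊗ E`: it maps `e_α ⊗ x` to `e_{jα} ⊗ x`. -/
def creationFun (j : ι) (ξ : List ι → E) : List ι → E
  | [] => 0
  | i :: α => open Classical in if i = j then ξ α else 0

theorem creationFun_cons_self (j : ι) (ξ : List ι → E) (α : List ι) :
    creationFun j ξ (j :: α) = ξ α := by simp [creationFun]

theorem creationFun_of_notMem (j : ι) (ξ : List ι → E) (β : List ι)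
    (h : β ∉ Set.range (List.cons j)) : creationFun j ξ β = 0 := by
  cases β with
  | nil => rfl
  | cons i α =>
    have : i ≠ j := by
      rintro rfl
      exact h ⟨α, rfl⟩
    simp [creationFun, this]

theorem hasSum_creationFun (j : ι) (ξ : Fock ι E) :
    HasSum (fun β => ‖creationFun j ξ β‖ ^ 2) (‖ξ‖ ^ 2) := by
  rw [← (List.cons_injective (a := j)).hasSum_iff]
  · convert norm_sq_eq ξ using 2 with α
    simp [creationFun_cons_self]
  · intro β hβ
    simp [creationFun_of_notMem j (ξ : List ι → E) β hβ]

/-- The left creation operator `L_j ⊗ I` as an isometry of `Γ ⊗ E`. -/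
def creation (j : ι) : Fock ι E →ₗᵢ[ℂ] Fock ι E where
  toFun ξ := ⟨creationFun j ξ, memℓp_gen (by simpa using (hasSum_creationFun j ξ).summable)⟩
  map_add' ξ η := by
    ext β
    cases β with
    | nil => exact (add_zero (0 : E)).symm
    | cons i α =>
      change creationFun j (ξ + η : Fock ι E) (i :: α) =
        creationFun j ξ (i :: α) + creationFun j η (i :: α)
      by_cases h : i = j <;> simp [creationFun, h, L2.add_apply]
  map_smul' c ξ := by
    ext β
    cases β with
    | nil => exact (smul_zero c).symm
    | cons i α =>
      change creationFun j (c • ξ : Fock ι E) (i :: α) = c • creationFun j ξ (i :: α)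
      by_cases h : i = j <;> simp [creationFun, h, L2.smul_apply]
  norm_map' ξ := by
    have h1 := norm_sq_eq (ι := List ι) (E := E)
      ⟨creationFun j ξ, memℓp_gen (by simpa using (hasSum_creationFun j ξ).summable)⟩
    have h2 := h1.unique (hasSum_creationFun j ξ)
    exact (sq_eq_sq₀ (norm_nonneg _) (norm_nonneg _)).1 h2

theorem creation_apply (j : ι) (ξ : Fock ι E) (β : List ι) :
    creation j ξ β = creationFun j ξ β := rfl

theorem inner_creation_of_ne {i j : ι} (h : i ≠ j) (ξ η : Fock ι E) :
    ⟪creation i ξ, creation j η⟫_ℂ = 0 := by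
  rw [inner_eq_tsum]
  convert tsum_zero with β
  cases β with
  | nil => simp [creation_apply, creationFun]
  | cons k α =>
    by_cases hk : k = i
    · have : k ≠ j := hk ▸ h
      simp [creation_apply, creationFun, this]
    · simp [creation_apply, creationFun, hk]

theorem inner_vacuum_creation (j : ι) (x : E) (ξ : Fock ι E) :
    ⟪(single [] x : Fock ι E), creation j ξ⟫_ℂ = 0 := by
  rw [inner_single_left, creation_apply]
  simp [creationFun]

/-- An isometric extension from a dense range: if `‖f x‖ = ‖e x‖` and `e` has dense range, the
isometry determined by `e x ↦ f x`. -/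
def extendIsometry {X F G : Type*} [NormedAddCommGroup X] [NormedSpace ℂ X]
    [NormedAddCommGroup F] [NormedSpace ℂ F] [NormedAddCommGroup G] [NormedSpace ℂ G]
    [CompleteSpace G] (e : X →L[ℂ] F) (he : DenseRange e) (f : X →L[ℂ] G)
    (h : ∀ x, ‖f x‖ = ‖e x‖) : F →ₗᵢ[ℂ] G where
  toLinearMap := (f.toLinearMap.extendOfNorm e.toLinearMap).toLinearMap
  norm_map' y := by
    refine he.induction_on y (isClosed_eq (by fun_prop) (by fun_prop)) fun x => ?_
    have := LinearMap.extendOfNorm_eq (f := f.toLinearMap) (e := e.toLinearMap) he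
      ⟨1, fun x => by simp [h]⟩ x
    exact (congrArg norm this).trans (h x)

theorem extendIsometry_apply {X F G : Type*} [NormedAddCommGroup X] [NormedSpace ℂ X]
    [NormedAddCommGroup F] [NormedSpace ℂ F] [NormedAddCommGroup G] [NormedSpace ℂ G]
    [CompleteSpace G] (e : X →L[ℂ] F) (he : DenseRange e) (f : X →L[ℂ] G)
    (h : ∀ x, ‖f x‖ = ‖e x‖) (x : X) : extendIsometry e he f h (e x) = f x :=
  LinearMap.extendOfNorm_eq (f := f.toLinearMap) (e := e.toLinearMap) he
    ⟨1, fun x => by simp [h]⟩ x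

end Hilbert

/-! ### Defect operators and defect spaces of a contraction -/

section Defect

variable {E F : Type*} [NormedAddCommGroup E] [InnerProductSpace ℂ E] [CompleteSpace E]
  [NormedAddCommGroup F] [InnerProductSpace ℂ F] [CompleteSpace F]

/-- The defect operator `(I - T* T)^{1/2}` of a contraction `T` between Hilbert spaces. -/
def defectOp (T : E →L[ℂ] F) : E →L[ℂ] E :=
  CFC.sqrt (1 - T.adjoint ∘L T)

/-- The defect space of `T`: the closure of the range of the defect operator. -/
abbrev defectSpace (T : E →L[ℂ] F) : Submodule ℂ E :=
  (LinearMap.range (defectOp T).toLinearMap).topologicalClosure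

/-- The defect operator as a map into the defect space. -/
def defectMap (T : E →L[ℂ] F) : E →L[ℂ] defectSpace T :=
  (defectOp T).codRestrict (defectSpace T)
    fun x => Submodule.le_topologicalClosure _ ⟨x, rfl⟩

theorem denseRange_defectMap (T : E →L[ℂ] F) : DenseRange (defectMap T) := by
  intro y
  rw [Topology.IsInducing.subtypeVal.closure_eq_preimage_closure_image]
  have : ((fun x : defectSpace T => (x : E)) '' Set.range (defectMap T)) =
      (LinearMap.range (defectOp T).toLinearMap : Set E) := by
    ext z
    constructor
    · rintro ⟨_, ⟨x, rfl⟩, rfl⟩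
      exact ⟨x, rfl⟩
    · rintro ⟨x, rfl⟩
      exact ⟨defectMap T x, ⟨x, rfl⟩, rfl⟩
  have hy : (y : E) ∈ closure (LinearMap.range (defectOp T).toLinearMap : Set E) := y.2
  rw [← this] at hy
  exact hy

theorem inner_defectMap {T : E →L[ℂ] F} (hT : ‖T‖ ≤ 1) (x y : E) :
    ⟪defectMap T x, defectMap T y⟫_ℂ = ⟪x, y⟫_ℂ - ⟪T x, T y⟫_ℂ := by
  have hnn : (0 : E →L[ℂ] E) ≤ 1 - T.adjoint ∘L T := by
    rw [ContinuousLinearMap.nonneg_iff_isPositive]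
    refine ⟨?_, fun x => ?_⟩
    · intro x y
      simp [inner_sub_left, inner_sub_right, ContinuousLinearMap.adjoint_inner_left,
        ContinuousLinearMap.adjoint_inner_right]
    · have h1 : ‖T x‖ ≤ ‖x‖ := (T.le_of_opNorm_le hT x).trans (by simp)
      simp only [ContinuousLinearMap.reApplyInnerSelf, sub_apply,
        one_apply_eq_self, ContinuousLinearMap.comp_apply, inner_sub_left,
        ContinuousLinearMap.adjoint_inner_left, map_sub, inner_self_eq_norm_sq]
      have := norm_nonneg (T x)
      nlinarith
  have hs : (defectOp T).adjoint = defectOp T :=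
    (CFC.sqrt_nonneg (1 - T.adjoint ∘L T)).isSelfAdjoint
  have hm : defectOp T (defectOp T y) = y - T.adjoint (T y) := by
    have := congrArg (fun S : E →L[ℂ] E => S y)
      (CFC.sqrt_mul_sqrt_self (1 - T.adjoint ∘L T) hnn)
    simpa [defectOp] using this
  change ⟪defectOp T x, defectOp T y⟫_ℂ = _
  rw [← ContinuousLinearMap.adjoint_inner_right, hs, hm, inner_sub_right,
    ContinuousLinearMap.adjoint_inner_right]

theorem norm_sq_defectMap {T : E →L[ℂ] F} (hT : ‖T‖ ≤ 1) (x : E) :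
    ‖defectMap T x‖ ^ 2 = ‖x‖ ^ 2 - ‖T x‖ ^ 2 := by
  have := congrArg Complex.re (inner_defectMap hT x x)
  simpa [← Complex.ofReal_pow] using this

end Defect

/-! ### Row contractions, row isometries, isometric dilations -/

section Tuples

variable {ι : Type*} {H K : Type*} [NormedAddCommGroup H] [InnerProductSpace ℂ H]
  [CompleteSpace H] [NormedAddCommGroup K] [InnerProductSpace ℂ K] [CompleteSpace K]

/-- `T_α = T_{α₁} ⋯ T_{α_m}` for a word `α = α₁ … α_m`; the empty word gives the identity. -/
def word {M : Type*} [Monoid M] (T : ι → M) (α : List ι) : M :=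
  (α.map T).prod

/-- A tuple `T = (T_i)` of operators on `H` is a row contraction if `(x_i) ↦ ∑ T_i x_i` is a
contraction from the direct sum of copies of `H` to `H`. -/
def IsRowContraction (T : ι → H →L[ℂ] H) : Prop :=
  ∃ R : L2 ι H →L[ℂ] H, ‖R‖ ≤ 1 ∧ ∀ i x, R (single i x) = T i x

/-- The row operator `(x_i) ↦ ∑ T_i x_i` of a row contraction. -/
def IsRowContraction.row {T : ι → H →L[ℂ] H} (hT : IsRowContraction T) : L2 ι H →L[ℂ] H :=
  hT.choose

theorem IsRowContraction.norm_row_le {T : ι → H →L[ℂ] H} (hT : IsRowContraction T) :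
    ‖hT.row‖ ≤ 1 := hT.choose_spec.1

theorem IsRowContraction.row_single {T : ι → H →L[ℂ] H} (hT : IsRowContraction T) (i : ι)
    (x : H) : hT.row (single i x) = T i x := hT.choose_spec.2 i x

/-- `T` is completely non-coisometric if `z = 0` is the only vector with
`∑_{|α| = n} ‖T_α* z‖² = ‖z‖²` for all `n`. -/
def IsCompletelyNonCoisometric (T : ι → H →L[ℂ] H) : Prop :=
  ∀ z : H, (∀ n : ℕ, HasSum
    (fun α : {α : List ι // α.length = n} => ‖(word T α.1).adjoint z‖ ^ 2) (‖z‖ ^ 2)) → z = 0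

/-- A row isometry: the `V_i` are isometries with mutually orthogonal ranges. -/
def IsRowIsometry (V : ι → K →L[ℂ] K) : Prop :=
  (∀ i x, ‖V i x‖ = ‖x‖) ∧ ∀ i j, i ≠ j → ∀ x y, ⟪V i x, V j y⟫_ℂ = 0

/-- `V` on `K` is an isometric dilation of `T` on `H`, where `H` is regarded as a closed subspace
of `K` through the isometry `J` (so `J*` is the orthogonal projection onto `H`): `V` is a row
isometry and `T_α = P_H V_α |_H` for all words `α`. -/
def IsIsometricDilation (T : ι → H →L[ℂ] H) (J : H →ₗᵢ[ℂ] K) (V : ι → K →L[ℂ] K) : Prop :=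
  IsRowIsometry V ∧
    ∀ α : List ι, word T α =
      J.toContinuousLinearMap.adjoint ∘L word V α ∘L J.toContinuousLinearMap

/-- An isometric dilation is minimal if `K` is the smallest closed `V`-invariant subspace
containing `H`. -/
def IsMinimalIsometricDilation (T : ι → H →L[ℂ] H) (J : H →ₗᵢ[ℂ] K) (V : ι → K →L[ℂ] K) :
    Prop :=
  IsIsometricDilation T J V ∧
    ∀ N : Submodule ℂ K, IsClosed (N : Set K) → (∀ h, J h ∈ N) →
      (∀ i, ∀ x ∈ N, V i x ∈ N) → N = ⊤

end Tuples

/-! ### Contractive multi-analytic operators and their functional models -/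

/-- A contractive multi-analytic operator `M : Γ ⊗ D → Γ ⊗ L`: a contraction intertwining the
creation operators. -/
structure ContractiveMultiAnalytic (ι D L : Type*) [NormedAddCommGroup D]
    [InnerProductSpace ℂ D] [NormedAddCommGroup L] [InnerProductSpace ℂ L] where
  toCLM : Fock ι D →L[ℂ] Fock ι L
  norm_le : ‖toCLM‖ ≤ 1
  map_creation : ∀ j ξ, toCLM (creation j ξ) = creation j (toCLM ξ)

namespace ContractiveMultiAnalytic

variable {ι D L : Type*} [NormedAddCommGroup D] [InnerProductSpace ℂ D]
  [NormedAddCommGroup L] [InnerProductSpace ℂ L]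
  (M : ContractiveMultiAnalytic ι D L)

/-- The symbol `Θ : D → Γ ⊗ L`, `Θ δ = M (e_∅ ⊗ δ)`. -/
def symbol : D →L[ℂ] Fock ι L :=
  M.toCLM ∘L (single []).toContinuousLinearMap

variable [CompleteSpace D] [CompleteSpace L]

/-- The model space `(Γ ⊗ L) ⊕ closure (Δ (Γ ⊗ D))`, where `Δ = (I - M* M)^{1/2}`. -/
abbrev ModelSpace : Type _ := WithLp 2 (Fock ι L × defectSpace M.toCLM)

/-- The isometry of `closure (Δ (Γ ⊗ D))` determined by `Δ ξ ↦ Δ (L_j ⊗ I) ξ`. -/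
def residual (j : ι) : defectSpace M.toCLM →ₗᵢ[ℂ] defectSpace M.toCLM :=
  extendIsometry (defectMap M.toCLM) (denseRange_defectMap _)
    (defectMap M.toCLM ∘L (creation j).toContinuousLinearMap) fun ξ => by
      rw [← sq_eq_sq₀ (norm_nonneg _) (norm_nonneg _), ContinuousLinearMap.comp_apply,
        norm_sq_defectMap M.norm_le, norm_sq_defectMap M.norm_le]
      change ‖creation j ξ‖ ^ 2 - ‖M.toCLM (creation j ξ)‖ ^ 2 = _
      rw [M.map_creation, LinearIsometry.norm_map, LinearIsometry.norm_map]

/-- The row isometry of the functional model,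
`V_j (η ⊕ Δ ξ) = (L_j ⊗ I) η ⊕ Δ (L_j ⊗ I) ξ`. -/
def modelV (j : ι) : M.ModelSpace →L[ℂ] M.ModelSpace :=
  (LinearIsometry.withLpProdMap 2 (creation j) (M.residual j)).toContinuousLinearMap

/-- The isometry `W ξ = M ξ ⊕ Δ ξ` of `Γ ⊗ D` into the model space. -/
def modelW : Fock ι D →ₗᵢ[ℂ] M.ModelSpace where
  toFun ξ := WithLp.toLp 2 (M.toCLM ξ, defectMap M.toCLM ξ)
  map_add' x y := by simp [← WithLp.toLp_add]
  map_smul' c x := by simp [← WithLp.toLp_smul]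
  norm_map' x := by
    rw [← sq_eq_sq₀ (norm_nonneg _) (norm_nonneg _), WithLp.prod_norm_sq_eq_of_L2]
    change ‖M.toCLM x‖ ^ 2 + ‖defectMap M.toCLM x‖ ^ 2 = _
    rw [norm_sq_defectMap M.norm_le]
    ring

/-- The subspace `H_A` of the model space: the orthogonal complement of the range of `W`. -/
abbrev modelHA : Submodule ℂ M.ModelSpace :=
  (LinearMap.range M.modelW.toLinearMap)ᗮ

/-- The compression `P_{H_A} V_j |_{H_A}`. -/
def modelA (j : ι) : M.modelHA →L[ℂ] M.modelHA :=
  M.modelHA.subtypeL.adjoint ∘L M.modelV j ∘L M.modelHA.subtypeL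

end ContractiveMultiAnalytic

/-- A symbol `Θ : D → Γ ⊗ L` has no constant directions if `Θ δ ∈ e_∅ ⊗ L` only for `δ = 0`. -/
def NoConstantDirections {ι D L : Type*} [NormedAddCommGroup D] [InnerProductSpace ℂ D]
    [NormedAddCommGroup L] [InnerProductSpace ℂ L] (Θ : D →L[ℂ] Fock ι L) : Prop :=
  ∀ δ : D, (∃ l : L, Θ δ = single [] l) → δ = 0

/-! ### The minimal isometric dilation and the characteristic function of a row contraction -/

section CharFn

variable {ι : Type*} {H : Type*} [NormedAddCommGroup H] [InnerProductSpace ℂ H]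
  [CompleteSpace H] {A : ι → H →L[ℂ] H} (hA : IsRowContraction A)

/-- The defect space `D_A`, the closure of the range of `(I - A* A)^{1/2}`. -/
abbrev DefSp : Submodule ℂ (L2 ι H) := defectSpace hA.row

/-- The `*`-defect space `D_{*,A}`, the closure of the range of `(I - A A*)^{1/2}`. -/
abbrev DefSpStar : Submodule ℂ H := defectSpace hA.row.adjoint

/-- The space `H ⊕ (Γ ⊗ D_A)` of the minimal isometric dilation. -/
abbrev DilSpace : Type _ := WithLp 2 (H × Fock ι (DefSp hA))

/-- The embedding `h ↦ h ⊕ 0`. -/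
def dilInl : H →ₗᵢ[ℂ] DilSpace hA where
  toFun h := WithLp.toLp 2 (h, 0)
  map_add' x y := by simp [← WithLp.toLp_add]
  map_smul' c x := by simp [← WithLp.toLp_smul]
  norm_map' x := by
    rw [← sq_eq_sq₀ (norm_nonneg _) (norm_nonneg _), WithLp.prod_norm_sq_eq_of_L2]
    simp

/-- The embedding `ξ ↦ 0 ⊕ ξ`. -/
def dilInr : Fock ι (DefSp hA) →ₗᵢ[ℂ] DilSpace hA where
  toFun ξ := WithLp.toLp 2 (0, ξ)
  map_add' x y := by simp [← WithLp.toLp_add]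
  map_smul' c x := by simp [← WithLp.toLp_smul]
  norm_map' x := by
    rw [← sq_eq_sq₀ (norm_nonneg _) (norm_nonneg _), WithLp.prod_norm_sq_eq_of_L2]
    simp

/-- The row `(x_i) ↦ ∑ V_i (x_i ⊕ 0) = (∑ A_i x_i) ⊕ (e_∅ ⊗ D_A (x_i))` of the minimal isometric
dilation, restricted to the direct sum of copies of `H`. -/
def dilRow : L2 ι H →ₗᵢ[ℂ] DilSpace hA where
  toFun x := WithLp.toLp 2 (hA.row x, single [] (defectMap hA.row x))
  map_add' x y := by simp [← WithLp.toLp_add]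
  map_smul' c x := by simp [← WithLp.toLp_smul]
  norm_map' x := by
    rw [← sq_eq_sq₀ (norm_nonneg _) (norm_nonneg _), WithLp.prod_norm_sq_eq_of_L2]
    change ‖hA.row x‖ ^ 2 + ‖(single [] (defectMap hA.row x) : Fock ι (DefSp hA))‖ ^ 2 = _
    rw [LinearIsometry.norm_map, norm_sq_defectMap hA.norm_row_le]
    ring

theorem inner_dilRow_dilInl (x : L2 ι H) (h : H) :
    ⟪dilRow hA x, dilInl hA h⟫_ℂ = ⟪hA.row x, h⟫_ℂ := by
  rw [WithLp.prod_inner_apply]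
  change ⟪hA.row x, h⟫_ℂ + ⟪_, (0 : Fock ι (DefSp hA))⟫_ℂ = _
  rw [inner_zero_right, add_zero]

theorem inner_dilRow_dilInr (x : L2 ι H) (j : ι) (ξ : Fock ι (DefSp hA)) :
    ⟪dilRow hA x, dilInr hA (creation j ξ)⟫_ℂ = 0 := by
  rw [WithLp.prod_inner_apply]
  change ⟪hA.row x, (0 : H)⟫_ℂ + ⟪single [] (defectMap hA.row x), creation j ξ⟫_ℂ = _
  rw [inner_zero_right, inner_vacuum_creation, add_zero]

theorem inner_dilInl_dilInr (h : H) (ξ : Fock ι (DefSp hA)) :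
    ⟪dilInl hA h, dilInr hA ξ⟫_ℂ = 0 := by
  rw [WithLp.prod_inner_apply]
  simp [dilInl, dilInr]

/-- The linear map `h ⊕ ξ ↦ A_j h ⊕ (e_∅ ⊗ D_A (0, …, h, …, 0) + (L_j ⊗ I) ξ)`, with `h` in the
`j`-th place. -/
def dilVLin (j : ι) : DilSpace hA →ₗ[ℂ] DilSpace hA :=
  (dilRow hA).toLinearMap ∘ₗ (single j).toLinearMap ∘ₗ (WithLp.fstL 2 ℂ H _).toLinearMap +
    (dilInr hA).toLinearMap ∘ₗ (creation j).toLinearMap ∘ₗ (WithLp.sndL 2 ℂ H _).toLinearMap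

theorem dilVLin_apply (j : ι) (x : DilSpace hA) :
    dilVLin hA j x = dilRow hA (single j x.fst) + dilInr hA (creation j x.snd) := rfl

theorem inner_dilVLin (i j : ι) (x y : DilSpace hA) :
    ⟪dilVLin hA i x, dilVLin hA j y⟫_ℂ =
      ⟪(single i x.fst : L2 ι H), single j y.fst⟫_ℂ + ⟪creation i x.snd, creation j y.snd⟫_ℂ := by
  have h := inner_dilRow_dilInr hA (single j y.fst) i x.snd
  rw [← inner_conj_symm, map_eq_zero] at h
  rw [dilVLin_apply, dilVLin_apply, inner_add_left, inner_add_right, inner_add_right,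
    inner_dilRow_dilInr, h, LinearIsometry.inner_map_map, LinearIsometry.inner_map_map]
  simp

/-- The minimal isometric dilation of `A`: on `H ⊕ (Γ ⊗ D_A)`,
`V_j (h ⊕ ξ) = A_j h ⊕ (e_∅ ⊗ D_A (0, …, h, …, 0) + (L_j ⊗ I) ξ)`. -/
def dilV (j : ι) : DilSpace hA →ₗᵢ[ℂ] DilSpace hA :=
  (dilVLin hA j).isometryOfInner fun x y => by
    rw [inner_dilVLin, LinearIsometry.inner_map_map, LinearIsometry.inner_map_map,
      WithLp.prod_inner_apply]
    rfl

theorem dilV_apply (j : ι) (x : DilSpace hA) :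
    dilV hA j x = dilRow hA (single j x.fst) + dilInr hA (creation j x.snd) := rfl

theorem inner_dilV_of_ne {i j : ι} (h : i ≠ j) (x y : DilSpace hA) :
    ⟪dilV hA i x, dilV hA j y⟫_ℂ = 0 := by
  refine (inner_dilVLin hA i j x y).trans ?_
  rw [inner_single_single_of_ne h, inner_creation_of_ne h, add_zero]

/-- The map `h ↦ (I - ∑ V_i A_i*) h` on `H`; here `A* h = (A_i* h)_i`. -/
def starWanderingPre : H →L[ℂ] DilSpace hA :=
  (dilInl hA).toContinuousLinearMap -
    (dilRow hA).toContinuousLinearMap ∘L hA.row.adjoint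

theorem starWanderingPre_apply (h : H) :
    starWanderingPre hA h = dilInl hA h - dilRow hA (hA.row.adjoint h) := rfl

theorem norm_starWanderingPre (h : H) :
    ‖starWanderingPre hA h‖ = ‖defectMap hA.row.adjoint h‖ := by
  have hn : ‖hA.row.adjoint‖ ≤ 1 := by
    rw [LinearIsometryEquiv.norm_map]
    exact hA.norm_row_le
  have key : ⟪dilInl hA h, dilRow hA (hA.row.adjoint h)⟫_ℂ =
      ((‖hA.row.adjoint h‖ : ℝ) : ℂ) ^ 2 := by
    rw [← inner_conj_symm, inner_dilRow_dilInl, ← ContinuousLinearMap.adjoint_inner_right,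
      inner_self_eq_norm_sq_to_K]
    simp
  rw [← sq_eq_sq₀ (norm_nonneg _) (norm_nonneg _), norm_sq_defectMap hn, starWanderingPre_apply,
    norm_sub_sq (𝕜 := ℂ), key, LinearIsometry.norm_map, LinearIsometry.norm_map]
  have : RCLike.re (((‖hA.row.adjoint h‖ : ℝ) : ℂ) ^ 2) = ‖hA.row.adjoint h‖ ^ 2 := by
    rw [← Complex.ofReal_pow]
    exact Complex.ofReal_re _
  rw [this]
  ring

/-- The canonical isometry from `D_{*,A}` into the dilation space, with range `ker V*`, determined
by `D_{*,A} h ↦ (I - ∑ V_i A_i*) h`. -/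
def starWandering : DefSpStar hA →ₗᵢ[ℂ] DilSpace hA :=
  extendIsometry (defectMap hA.row.adjoint) (denseRange_defectMap _) (starWanderingPre hA)
    (norm_starWanderingPre hA)

theorem inner_starWandering_dilV (d : DefSpStar hA) (j : ι) (y : DilSpace hA) :
    ⟪starWandering hA d, dilV hA j y⟫_ℂ = 0 := by
  refine (denseRange_defectMap hA.row.adjoint).induction_on d
    (isClosed_eq (by fun_prop) (by fun_prop)) fun h => ?_
  have h1 : ⟪dilInl hA h, dilRow hA (single j y.fst)⟫_ℂ =
      ⟪hA.row.adjoint h, single j y.fst⟫_ℂ := by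
    rw [← inner_conj_symm, inner_dilRow_dilInl, inner_conj_symm,
      ContinuousLinearMap.adjoint_inner_left]
  rw [starWandering, extendIsometry_apply, starWanderingPre_apply, dilV_apply, inner_add_right,
    inner_sub_left, inner_sub_left, inner_dilInl_dilInr, inner_dilRow_dilInr, h1,
    LinearIsometry.inner_map_map]
  simp

/-- `V_α` applied to the wandering subspace `ker V*`, the latter identified with `D_{*,A}`. -/
def shiftFamily (α : List ι) : DefSpStar hA →ₗᵢ[ℂ] DilSpace hA :=
  (word (dilV hA) α).comp (starWandering hA)

theorem shiftFamily_cons (j : ι) (α : List ι) (d : DefSpStar hA) :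
    shiftFamily hA (j :: α) d = dilV hA j (shiftFamily hA α d) := by
  simp [shiftFamily, word]

theorem shiftFamily_nil (d : DefSpStar hA) : shiftFamily hA [] d = starWandering hA d := by
  simp [shiftFamily, word]

theorem orthogonalFamily_shiftFamily :
    OrthogonalFamily ℂ (fun _ : List ι => DefSpStar hA) (shiftFamily hA) := by
  intro α
  induction α with
  | nil =>
    intro β hβ c d
    cases β with
    | nil => exact absurd rfl hβ
    | cons j β =>
      rw [shiftFamily_nil, shiftFamily_cons]
      exact inner_starWandering_dilV hA _ _ _
  | cons i α ih =>
    intro β hβ c d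
    cases β with
    | nil =>
      rw [shiftFamily_nil, shiftFamily_cons, ← inner_conj_symm, inner_starWandering_dilV, map_zero]
    | cons j β =>
      rw [shiftFamily_cons, shiftFamily_cons]
      by_cases hij : i = j
      · subst hij
        rw [LinearIsometry.inner_map_map]
        exact ih (fun h => hβ (by rw [h])) c d
      · exact inner_dilV_of_ne hA hij _ _

/-- The row shift part of the Wold decomposition of the minimal isometric dilation: the isometry
`Γ ⊗ D_{*,A} → H ⊕ (Γ ⊗ D_A)` that maps `e_α ⊗ d` to `V_α d`, where `d ∈ D_{*,A}` is identified
with a vector in `ker V*`. Its range is the closed span of all `V_α (ker V*)`. -/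
def shiftEmbedding : Fock ι (DefSpStar hA) →ₗᵢ[ℂ] DilSpace hA :=
  (orthogonalFamily_shiftFamily hA).linearIsometry

theorem shiftEmbedding_single (α : List ι) (d : DefSpStar hA) :
    shiftEmbedding hA (single α d) = shiftFamily hA α d := by
  classical
  rw [single_eq]
  exact (orthogonalFamily_shiftFamily hA).linearIsometry_apply_single (i := α) d

theorem adjoint_shiftEmbedding_dilV (j : ι) (x : DilSpace hA) :
    (shiftEmbedding hA).toContinuousLinearMap.adjoint (dilV hA j x) =
      creation j ((shiftEmbedding hA).toContinuousLinearMap.adjoint x) := by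
  have hc : ∀ (y : DilSpace hA) (α : List ι) (d : DefSpStar hA),
      ⟪(shiftEmbedding hA).toContinuousLinearMap.adjoint y α, d⟫_ℂ =
        ⟪y, shiftFamily hA α d⟫_ℂ := by
    intro y α d
    rw [← inner_single_right, ContinuousLinearMap.adjoint_inner_left]
    exact congrArg _ (shiftEmbedding_single hA α d)
  refine L2.ext fun β => ?_
  refine ext_inner_right ℂ fun d => ?_
  rw [hc, creation_apply]
  cases β with
  | nil =>
    rw [shiftFamily_nil, ← inner_conj_symm, inner_starWandering_dilV]
    simp [creationFun]
  | cons i α =>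
    rw [shiftFamily_cons]
    by_cases hij : i = j
    · subst hij
      rw [LinearIsometry.inner_map_map, creationFun_cons_self, hc]
    · rw [inner_dilV_of_ne hA (Ne.symm hij)]
      simp [creationFun, hij]

/-- The characteristic function of the row contraction `A`, as a contractive multi-analytic
operator `Γ ⊗ D_A → Γ ⊗ D_{*,A}`: the orthogonal projection of the dilation space onto the row
shift part, restricted to `Γ ⊗ D_A`, the row shift part being identified with `Γ ⊗ D_{*,A}`.
(The adjoint of an isometry `S` is the orthogonal projection onto its range followed by the
inverse of `S` on that range.) -/
def charFn : ContractiveMultiAnalytic ι (DefSp hA) (DefSpStar hA) where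
  toCLM := (shiftEmbedding hA).toContinuousLinearMap.adjoint ∘L
    (dilInr hA).toContinuousLinearMap
  norm_le := by
    refine (ContinuousLinearMap.opNorm_comp_le _ _).trans ?_
    rw [LinearIsometryEquiv.norm_map]
    exact mul_le_one₀ (LinearIsometry.norm_toContinuousLinearMap_le _) (norm_nonneg _)
      (LinearIsometry.norm_toContinuousLinearMap_le _)
  map_creation j ξ := by
    have : dilInr hA (creation j ξ) = dilV hA j (dilInr hA ξ) := by
      rw [dilV_apply]
      change _ = dilRow hA (single j 0) + dilInr hA (creation j ξ)
      simp
    change (shiftEmbedding hA).toContinuousLinearMap.adjoint (dilInr hA (creation j ξ)) = _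
    rw [this, adjoint_shiftEmbedding_dilV]
    rfl

end CharFn

end RowModel

end

/-!
Let `K = H ⊕ (Γ ⊗ D_A)` be the space of the minimal isometric dilation, `S : Γ ⊗ D_{*,A} → K` the
row shift part, `P = S S*`, and write `ξ` also for `0 ⊕ ξ`. Then `M = S*` on `Γ ⊗ D_A`, so that
`Δ² = I - M* M` is the compression of `I - P` to `Γ ⊗ D_A`. Hence `η ⊕ Δ ξ ↦ S η + (I - P) ξ` is
an isometry of the model space into `K` (`modelToDil`). It intertwines the row isometries, and it
sends `M ξ ⊕ Δ ξ` to `ξ`. If it is onto, it identifies `H_A` with `H` and the model tuple with `A`,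
and minimality of the model is minimality of the dilation (`eq_top_of_dilV_invariant`).

A vector orthogonal to the range of `modelToDil` is orthogonal to `Γ ⊗ D_A`, so it is some `z ∈ H`
with `S* z = 0`. The vectors `z ∈ H` with `S* z = 0` satisfy `‖z‖² = ∑ ‖A_i* z‖²`, and their images
`A_i* z` are again of this kind, since `V_i* z = A_i* z` and `V_i` maps the row shift part into
itself. Iterating, `∑_{|α| = n} ‖A_α* z‖² = ‖z‖²` for all `n`, so that `z = 0` when `A` is
completely non-coisometric (`eq_zero_of_shiftProj_dilInl`).

The same fact excludes constant directions. The coefficients of `Θ_A δ` at the words `jβ` are those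
of `S* (D_A δ)_j` at `β` (`charFn_symbol_cons`). If all of them vanish, then `D_A δ = 0`, and
`δ = 0` as `δ` lies in the closure of the range of `D_A`. Injectivity of the symbol is the case of
the constant `0`.
-/

noncomputable section

namespace RowModel

set_option linter.unusedSectionVars false

attribute [local instance 2000] InnerProductSpace.toInner

/-! ### Hilbert sums and isometries -/

section Sums

variable {ι : Type*} {E : Type*} [NormedAddCommGroup E] [InnerProductSpace ℂ E]

theorem hasSum_single (f : L2 ι E) : HasSum (fun i => (single i (f i) : L2 ι E)) f := by
  classical
  have := lp.hasSum_single (E := fun _ : ι => E) (p := 2) (by norm_num) f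
  simp only [← single_eq] at this
  exact this

/-- A closed subspace that contains all the summands is the whole direct sum. -/
theorem mem_of_single_mem {N : Submodule ℂ (L2 ι E)} (hN : IsClosed (N : Set (L2 ι E)))
    (h : ∀ i x, single i x ∈ N) (f : L2 ι E) : f ∈ N :=
  hN.mem_of_tendsto (hasSum_single f)
    (Filter.Eventually.of_forall fun _ => N.sum_mem fun i _ => h i (f i))

theorem creation_single (j : ι) (α : List ι) (x : E) :
    creation j (single α x : Fock ι E) = single (j :: α) x := by
  refine L2.ext fun β => ?_
  classical
  have hs : ∀ α β : List ι, (single α x : Fock ι E) β = if β = α then x else 0 := by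
    intro α β
    rw [single_eq]
    by_cases h : β = α
    · subst h
      rw [if_pos rfl]
      exact lp.single_apply_self (E := fun _ : List ι => E) 2 β x
    · rw [if_neg h]
      exact lp.single_apply_ne (E := fun _ : List ι => E) 2 α x h
  rw [creation_apply, hs]
  cases β with
  | nil => simp [creationFun]
  | cons i β =>
    by_cases hi : i = j
    · subst hi
      rw [creationFun_cons_self, hs]
      simp
    · simp [creationFun, hi]

variable {F K : Type*} [NormedAddCommGroup F] [InnerProductSpace ℂ F]
  [NormedAddCommGroup K] [InnerProductSpace ℂ K]

/-- The isometry `x ⊕ y ↦ f x + g y` determined by two isometries with orthogonal ranges. -/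
def coprodIsometry (f : E →ₗᵢ[ℂ] K) (g : F →ₗᵢ[ℂ] K) (h : ∀ x y, ⟪f x, g y⟫_ℂ = 0) :
    WithLp 2 (E × F) →ₗᵢ[ℂ] K :=
  (f.toLinearMap ∘ₗ (WithLp.fstL 2 ℂ E F).toLinearMap +
    g.toLinearMap ∘ₗ (WithLp.sndL 2 ℂ E F).toLinearMap).isometryOfInner fun x y => by
      change ⟪f x.fst + g x.snd, f y.fst + g y.snd⟫_ℂ = _
      have h' : ⟪g x.snd, f y.fst⟫_ℂ = 0 := by rw [← inner_conj_symm, h, map_zero]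
      rw [inner_add_left, inner_add_right, inner_add_right, h, h', LinearIsometry.inner_map_map,
        LinearIsometry.inner_map_map, WithLp.prod_inner_apply]
      simp

theorem adjoint_apply_self [CompleteSpace E] [CompleteSpace K] (f : E →ₗᵢ[ℂ] K) (x : E) :
    f.toContinuousLinearMap.adjoint (f x) = x :=
  ext_inner_right ℂ fun y => by
    rw [ContinuousLinearMap.adjoint_inner_left]
    exact f.inner_map_map x y

/-- An isometry between Hilbert spaces is onto once no nonzero vector is orthogonal to its
range. -/
theorem surjective_of_orthogonal_eq_zero [CompleteSpace E] [CompleteSpace K] (f : E →ₗᵢ[ℂ] K)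
    (h : ∀ y, (∀ x, ⟪f x, y⟫_ℂ = 0) → y = 0) : Function.Surjective f := by
  intro y
  refine ⟨f.toContinuousLinearMap.adjoint y, (sub_eq_zero.1 (h _ fun x => ?_)).symm⟩
  rw [inner_sub_right, LinearIsometry.inner_map_map, ContinuousLinearMap.adjoint_inner_right]
  exact sub_self _

end Sums

/-! ### Words of liftings and of adjoints -/

section Dilation

variable {ι : Type*} {H K : Type*} [NormedAddCommGroup H] [InnerProductSpace ℂ H]
  [CompleteSpace H] [NormedAddCommGroup K] [InnerProductSpace ℂ K] [CompleteSpace K]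

/-- If `V` is a lifting of `T`, in the sense that `P_H V_j = T_j P_H`, then the compression of
`V_α` is `T_α` for every word `α`. -/
theorem word_eq_compression {T : ι → H →L[ℂ] H} {J : H →ₗᵢ[ℂ] K} {V : ι → K →L[ℂ] K}
    (h : ∀ j x, J.toContinuousLinearMap.adjoint (V j x) =
      T j (J.toContinuousLinearMap.adjoint x)) (α : List ι) :
    word T α = J.toContinuousLinearMap.adjoint ∘L word V α ∘L J.toContinuousLinearMap := by
  have hw : ∀ x, J.toContinuousLinearMap.adjoint (word V α x) =
      word T α (J.toContinuousLinearMap.adjoint x) := by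
    induction α with
    | nil => simp [word]
    | cons i α ih =>
      intro x
      have := h i (word V α x)
      rw [ih] at this
      simpa [word] using this
  ext x
  have := hw (J x)
  rw [adjoint_apply_self] at this
  exact this.symm

/-- If `z` lies in a set on which `‖w‖² = ∑ ‖T_i* w‖²` and which is invariant under all `T_i*`,
then `∑_{|α| = n} ‖T_α* z‖² = ‖z‖²` for every `n`. -/
theorem hasSum_norm_sq_adjoint_word {T : ι → H →L[ℂ] H} {N : Set H}
    (hinv : ∀ i, ∀ z ∈ N, (T i).adjoint z ∈ N)
    (hsum : ∀ z ∈ N, HasSum (fun i => ‖(T i).adjoint z‖ ^ 2) (‖z‖ ^ 2)) (n : ℕ) :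
    ∀ z ∈ N, HasSum
      (fun α : {α : List ι // α.length = n} => ‖(word T α.1).adjoint z‖ ^ 2) (‖z‖ ^ 2) := by
  induction n with
  | zero =>
    intro z _
    let u : {α : List ι // α.length = 0} := ⟨[], rfl⟩
    have hu : ‖(word T u.1).adjoint z‖ ^ 2 = ‖z‖ ^ 2 := by
      have : (word T u.1).adjoint = 1 := by
        change (1 : H →L[ℂ] H).adjoint = 1
        exact star_one _
      rw [this]
      rfl
    rw [← hu]
    exact _root_.hasSum_single u fun α hα => absurd (Subtype.ext (List.length_eq_zero_iff.1 α.2)) hα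
  | succ n ih =>
    intro z hz
    let e : ι × {α : List ι // α.length = n} → {α : List ι // α.length = n + 1} :=
      fun p => ⟨p.1 :: p.2.1, by simp [p.2.2]⟩
    have he : Function.Bijective e := by
      constructor
      · rintro ⟨i, α, hα⟩ ⟨j, β, hβ⟩ h
        simpa [e] using h
      · rintro ⟨_ | ⟨i, α⟩, hα⟩
        · simp at hα
        · exact ⟨(i, ⟨α, by simpa using hα⟩), rfl⟩
    rw [← (Equiv.ofBijective e he).hasSum_iff]
    have hfun : ((fun α : {α : List ι // α.length = n + 1} => ‖(word T α.1).adjoint z‖ ^ 2) ∘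
        Equiv.ofBijective e he) =
        fun p => ‖(word T p.2.1).adjoint ((T p.1).adjoint z)‖ ^ 2 := by
      funext p
      have : word T (p.1 :: p.2.1) = T p.1 ∘L word T p.2.1 := by simp [word]; rfl
      simp only [Function.comp, Equiv.ofBijective_apply, e, this,
        ContinuousLinearMap.adjoint_comp, ContinuousLinearMap.comp_apply]
    rw [hfun]
    have hi := fun i => ih _ (hinv i z hz)
    have hs : Summable fun p : ι × {α : List ι // α.length = n} =>
        ‖(word T p.2.1).adjoint ((T p.1).adjoint z)‖ ^ 2 := by
      rw [summable_prod_of_nonneg fun _ => by positivity]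
      refine ⟨fun i => (hi i).summable, ?_⟩
      simp only [(hi _).tsum_eq]
      exact (hsum z hz).summable
    have h := hs.hasSum
    rwa [(h.prod_fiberwise hi).unique (hsum z hz)] at h

end Dilation

/-! ### The minimal isometric dilation and its row shift part -/

section MinimalDilation

variable {ι : Type*} {H : Type*} [NormedAddCommGroup H] [InnerProductSpace ℂ H]
  [CompleteSpace H] {A : ι → H →L[ℂ] H} (hA : IsRowContraction A)

theorem adjoint_row_apply (z : H) (i : ι) : hA.row.adjoint z i = (A i).adjoint z :=
  ext_inner_right ℂ fun h => by
    rw [← inner_single_right, ContinuousLinearMap.adjoint_inner_left,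
      ContinuousLinearMap.adjoint_inner_left, hA.row_single]

theorem dilSpace_eq (x : DilSpace hA) : x = dilInl hA x.fst + dilInr hA x.snd := by
  apply (WithLp.equiv 2 _).injective
  ext <;> simp [dilInl, dilInr]

theorem dilRow_eq (x : L2 ι H) :
    dilRow hA x = dilInl hA (hA.row x) + dilInr hA (single [] (defectMap hA.row x)) :=
  dilSpace_eq hA (dilRow hA x)

theorem dilV_dilInl (j : ι) (h : H) : dilV hA j (dilInl hA h) = dilRow hA (single j h) := by
  rw [dilV_apply]
  change dilRow hA (single j h) + dilInr hA (creation j 0) = _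
  simp

theorem dilV_dilInr (j : ι) (ξ : Fock ι (DefSp hA)) :
    dilV hA j (dilInr hA ξ) = dilInr hA (creation j ξ) := by
  rw [dilV_apply]
  change dilRow hA (single j 0) + dilInr hA (creation j ξ) = _
  simp

theorem inner_dilInl_dilV (h : H) (j : ι) (x : DilSpace hA) :
    ⟪dilInl hA h, dilV hA j x⟫_ℂ = ⟪dilInl hA ((A j).adjoint h), x⟫_ℂ := by
  have h1 : ⟪dilInl hA h, dilRow hA (single j x.fst)⟫_ℂ = ⟪h, A j x.fst⟫_ℂ := by
    rw [← inner_conj_symm, inner_dilRow_dilInl, inner_conj_symm, hA.row_single]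
  rw [dilV_apply, inner_add_right, inner_dilInl_dilInr, h1]
  conv_rhs => rw [dilSpace_eq hA x]
  rw [inner_add_right, inner_dilInl_dilInr, LinearIsometry.inner_map_map,
    ContinuousLinearMap.adjoint_inner_left]

/-- The dilation space is generated by `H`: from `V_j h` one obtains `e_∅ ⊗ D_A x`, and the `V_j`
act as `L_j ⊗ I` on `Γ ⊗ D_A`. -/
theorem eq_top_of_dilV_invariant {N : Submodule ℂ (DilSpace hA)}
    (hN : IsClosed (N : Set (DilSpace hA))) (hH : ∀ h, dilInl hA h ∈ N)
    (hV : ∀ j, ∀ x ∈ N, dilV hA j x ∈ N) : N = ⊤ := by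
  have hrow : ∀ x, dilRow hA x ∈ N := fun x =>
    mem_of_single_mem (N := N.comap (dilRow hA).toLinearMap)
      (hN.preimage (dilRow hA).continuous)
      (fun i x => by
        have := hV i _ (hH x)
        rwa [dilV_dilInl] at this) x
  have hvac : ∀ d, dilInr hA (single [] d) ∈ N := fun d =>
    (denseRange_defectMap hA.row).induction_on d
      (hN.preimage ((dilInr hA).continuous.comp (single []).continuous)) fun x => by
        have := N.sub_mem (hrow x) (hH (hA.row x))
        rwa [dilRow_eq, add_sub_cancel_left] at this
  have hword : ∀ (α : List ι) d, dilInr hA (single α d) ∈ N := by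
    intro α
    induction α with
    | nil => exact hvac
    | cons j α ih =>
      intro d
      have := hV j _ (ih d)
      rwa [dilV_dilInr, creation_single] at this
  have hinr : ∀ ξ, dilInr hA ξ ∈ N :=
    mem_of_single_mem (N := N.comap (dilInr hA).toLinearMap)
      (hN.preimage (dilInr hA).continuous) hword
  rw [eq_top_iff]
  intro x _
  rw [dilSpace_eq hA x]
  exact N.add_mem (hH _) (hinr _)

/-- The adjoint of `shiftEmbedding`: the projection of the dilation space onto its row shift part,
followed by the identification of that part with `Γ ⊗ D_{*,A}`. -/
abbrev shiftProj : DilSpace hA →L[ℂ] Fock ι (DefSpStar hA) :=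
  (shiftEmbedding hA).toContinuousLinearMap.adjoint

theorem inner_shiftProj_left (x : DilSpace hA) (η : Fock ι (DefSpStar hA)) :
    ⟪shiftProj hA x, η⟫_ℂ = ⟪x, shiftEmbedding hA η⟫_ℂ :=
  ContinuousLinearMap.adjoint_inner_left _ _ _

theorem inner_shiftProj_apply (x : DilSpace hA) (α : List ι) (d : DefSpStar hA) :
    ⟪shiftProj hA x α, d⟫_ℂ = ⟪x, shiftFamily hA α d⟫_ℂ := by
  rw [← inner_single_right, inner_shiftProj_left, shiftEmbedding_single]

theorem dilV_shiftEmbedding (j : ι) (η : Fock ι (DefSpStar hA)) :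
    dilV hA j (shiftEmbedding hA η) = shiftEmbedding hA (creation j η) := by
  refine mem_of_single_mem
    (N := LinearMap.eqLocus ((dilV hA j).comp (shiftEmbedding hA)).toLinearMap
      ((shiftEmbedding hA).comp (creation j)).toLinearMap)
    (isClosed_eq ((dilV hA j).comp (shiftEmbedding hA)).continuous
      ((shiftEmbedding hA).comp (creation j)).continuous) (fun α d => ?_) η
  change dilV hA j (shiftEmbedding hA (single α d)) =
    shiftEmbedding hA (creation j (single α d))
  rw [creation_single, shiftEmbedding_single, shiftEmbedding_single, shiftFamily_cons]

/-- The vectors of `H` orthogonal to the row shift part span the coisometric part of `A`, so there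
are none in the completely non-coisometric case. -/
theorem eq_zero_of_shiftProj_dilInl (hcnc : IsCompletelyNonCoisometric A) {z : H}
    (hz : shiftProj hA (dilInl hA z) = 0) : z = 0 := by
  refine hcnc z fun n => hasSum_norm_sq_adjoint_word
    (N := {z | shiftProj hA (dilInl hA z) = 0}) (fun i z (hz : _ = 0) => ?_)
    (fun z (hz : _ = 0) => ?_) n z hz
  · refine ext_inner_right ℂ fun η => ?_
    rw [inner_shiftProj_left, ← inner_dilInl_dilV, dilV_shiftEmbedding, ← inner_shiftProj_left,
      hz, inner_zero_left, inner_zero_left]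
  · -- Orthogonality to `(I - ∑ V_i A_i*) z` is the equation `‖z‖² = ‖A* z‖²`.
    have h0 : ⟪dilInl hA z, starWanderingPre hA z⟫_ℂ = 0 := by
      rw [← extendIsometry_apply (defectMap hA.row.adjoint) (denseRange_defectMap _)
        (starWanderingPre hA) (norm_starWanderingPre hA)]
      change ⟪_, starWandering hA _⟫_ℂ = 0
      rw [← shiftFamily_nil, ← inner_shiftProj_apply, hz]
      exact inner_zero_left _
    have h1 : ⟪dilInl hA z, dilRow hA (hA.row.adjoint z)⟫_ℂ =
        ⟪hA.row.adjoint z, hA.row.adjoint z⟫_ℂ := by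
      rw [← inner_conj_symm, inner_dilRow_dilInl, inner_conj_symm,
        ContinuousLinearMap.adjoint_inner_left]
    rw [starWanderingPre_apply, inner_sub_right, LinearIsometry.inner_map_map, h1] at h0
    have h2 : ‖z‖ ^ 2 = ‖hA.row.adjoint z‖ ^ 2 := by
      have := congrArg Complex.re (sub_eq_zero.1 h0)
      simpa [← Complex.ofReal_pow] using this
    rw [h2]
    simpa only [adjoint_row_apply] using norm_sq_eq (hA.row.adjoint z)

end MinimalDilation

/-! ### The symbol of the characteristic function -/

section Symbol

variable {ι : Type*} {H : Type*} [NormedAddCommGroup H] [InnerProductSpace ℂ H]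
  [CompleteSpace H] {A : ι → H →L[ℂ] H} (hA : IsRowContraction A)

theorem eq_zero_of_defectOp_eq_zero {E F : Type*} [NormedAddCommGroup E] [InnerProductSpace ℂ E]
    [CompleteSpace E] [NormedAddCommGroup F] [InnerProductSpace ℂ F] [CompleteSpace F]
    (T : E →L[ℂ] F) {d : defectSpace T} (hd : defectOp T d = 0) : d = 0 := by
  have hs : (defectOp T).adjoint = defectOp T :=
    (CFC.sqrt_nonneg (1 - T.adjoint ∘L T)).isSelfAdjoint
  refine (denseRange_defectMap T).eq_zero_of_inner_left ℂ fun v => ?_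
  change ⟪(d : E), defectOp T v⟫_ℂ = 0
  rw [← ContinuousLinearMap.adjoint_inner_left, hs, hd, inner_zero_left]

/-- The coefficients of `Θ_A δ` at the words beginning with `j` are those of the projection onto
the row shift part of `V_j* (e_∅ ⊗ δ) = (D_A δ)_j`. -/
theorem charFn_symbol_cons (δ : DefSp hA) (j : ι) (β : List ι) :
    (charFn hA).symbol δ (j :: β) =
      shiftProj hA (dilInl hA (defectOp hA.row δ j)) β := by
  have hs : (defectOp hA.row).adjoint = defectOp hA.row :=
    (CFC.sqrt_nonneg (1 - hA.row.adjoint ∘L hA.row)).isSelfAdjoint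
  refine ext_inner_right ℂ fun d => ?_
  change ⟪shiftProj hA (dilInr hA (single [] δ)) (j :: β), d⟫_ℂ = _
  rw [inner_shiftProj_apply, inner_shiftProj_apply, shiftFamily_cons]
  generalize shiftFamily hA β d = y
  have h1 : ⟪dilInr hA (single [] δ), dilInl hA (hA.row (single j y.fst))⟫_ℂ = 0 := by
    rw [← inner_conj_symm, inner_dilInl_dilInr, map_zero]
  rw [dilV_apply, dilRow_eq, inner_add_right, inner_add_right, h1, LinearIsometry.inner_map_map,
    LinearIsometry.inner_map_map, LinearIsometry.inner_map_map, inner_vacuum_creation]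
  conv_rhs => rw [dilSpace_eq hA y, inner_add_right, inner_dilInl_dilInr,
    LinearIsometry.inner_map_map, ← inner_single_right, ← hs,
    ContinuousLinearMap.adjoint_inner_left]
  rw [zero_add]
  rfl

theorem charFn_noConstantDirections (hcnc : IsCompletelyNonCoisometric A) :
    NoConstantDirections (charFn hA).symbol := by
  rintro δ ⟨l, hl⟩
  refine eq_zero_of_defectOp_eq_zero hA.row (L2.ext fun j => ?_)
  refine eq_zero_of_shiftProj_dilInl hA hcnc (L2.ext fun β => ?_)
  rw [← charFn_symbol_cons, hl]
  classical
  rw [single_eq]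
  exact lp.single_apply_ne (E := fun _ : List ι => DefSpStar hA) 2 [] l (List.cons_ne_nil j β)

theorem charFn_symbol_injective (hcnc : IsCompletelyNonCoisometric A) :
    Function.Injective (charFn hA).symbol :=
  (injective_iff_map_eq_zero _).2 fun δ hδ =>
    charFn_noConstantDirections hA hcnc δ ⟨0, by rw [hδ, map_zero]⟩

end Symbol

/-! ### The functional model -/

section Model

namespace ContractiveMultiAnalytic

variable {ι D L : Type*} [NormedAddCommGroup D] [InnerProductSpace ℂ D]
  [NormedAddCommGroup L] [InnerProductSpace ℂ L] [CompleteSpace D] [CompleteSpace L]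
  (M : ContractiveMultiAnalytic ι D L)

theorem residual_defectMap (j : ι) (ξ : Fock ι D) :
    M.residual j (defectMap M.toCLM ξ) = defectMap M.toCLM (creation j ξ) :=
  extendIsometry_apply _ _ _ _ ξ

theorem modelV_modelW (j : ι) (ξ : Fock ι D) :
    M.modelV j (M.modelW ξ) = M.modelW (creation j ξ) := by
  change WithLp.toLp 2 (creation j (M.toCLM ξ), M.residual j (defectMap M.toCLM ξ)) =
    WithLp.toLp 2 (M.toCLM (creation j ξ), defectMap M.toCLM (creation j ξ))
  rw [residual_defectMap, M.map_creation]

theorem adjoint_subtype_modelW (ξ : Fock ι D) :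
    M.modelHA.subtypeₗᵢ.toContinuousLinearMap.adjoint (M.modelW ξ) = 0 :=
  ext_inner_right ℂ fun h => by
    rw [ContinuousLinearMap.adjoint_inner_left, inner_zero_left]
    exact (Submodule.mem_orthogonal _ _).1 h.2 _ ⟨ξ, rfl⟩

theorem modelA_eq_of_modelV_eq {j : ι} {x y : M.modelHA} {ξ : Fock ι D}
    (h : M.modelV j x = (y : M.ModelSpace) + M.modelW ξ) : M.modelA j x = y := by
  change M.modelHA.subtypeₗᵢ.toContinuousLinearMap.adjoint (M.modelV j x) = y
  rw [h, map_add, adjoint_subtype_modelW, add_zero]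
  exact adjoint_apply_self M.modelHA.subtypeₗᵢ y

/-- `V` is a lifting of the model tuple, since the range of `W`, the orthogonal complement of
`H_A`, is invariant under the `V_j`. -/
theorem adjoint_subtype_modelV (j : ι) (x : M.ModelSpace) :
    M.modelHA.subtypeₗᵢ.toContinuousLinearMap.adjoint (M.modelV j x) =
      M.modelA j (M.modelHA.subtypeₗᵢ.toContinuousLinearMap.adjoint x) := by
  set J := M.modelHA.subtypeₗᵢ
  set P := J.toContinuousLinearMap.adjoint
  have hW : ∀ ξ, P (M.modelW ξ) = 0 := M.adjoint_subtype_modelW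
  obtain ⟨h, ξ, hx⟩ : ∃ h ξ, x = J h + M.modelW ξ := by
    refine ⟨⟨x - M.modelW (M.modelW.toContinuousLinearMap.adjoint x), ?_⟩, _,
      (sub_add_cancel x _).symm⟩
    rw [Submodule.mem_orthogonal]
    rintro _ ⟨ξ, rfl⟩
    change ⟪M.modelW ξ, _⟫_ℂ = 0
    rw [inner_sub_right, LinearIsometry.inner_map_map, ContinuousLinearMap.adjoint_inner_right]
    exact sub_self _
  have hP : P x = h := by rw [hx, map_add, hW, add_zero, adjoint_apply_self]
  change P (M.modelV j x) = P (M.modelV j (J (P x)))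
  rw [hP, hx, map_add, map_add, modelV_modelW, hW, add_zero]

end ContractiveMultiAnalytic

variable {ι : Type*} {H : Type*} [NormedAddCommGroup H] [InnerProductSpace ℂ H]
  [CompleteSpace H] {A : ι → H →L[ℂ] H} (hA : IsRowContraction A)

/-- The orthogonal projection of the dilation space onto the complement of the row shift part. -/
def dilResidual : DilSpace hA →L[ℂ] DilSpace hA :=
  1 - (shiftEmbedding hA).toContinuousLinearMap ∘L shiftProj hA

theorem dilResidual_apply (x : DilSpace hA) :
    dilResidual hA x = x - shiftEmbedding hA (shiftProj hA x) := rfl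

theorem inner_shiftEmbedding_dilResidual (η : Fock ι (DefSpStar hA)) (x : DilSpace hA) :
    ⟪shiftEmbedding hA η, dilResidual hA x⟫_ℂ = 0 := by
  rw [dilResidual_apply, inner_sub_right, LinearIsometry.inner_map_map, sub_eq_zero,
    ← inner_conj_symm, ← inner_shiftProj_left, inner_conj_symm]

theorem norm_sq_dilResidual (x : DilSpace hA) :
    ‖dilResidual hA x‖ ^ 2 = ‖x‖ ^ 2 - ‖shiftProj hA x‖ ^ 2 := by
  have h := norm_add_sq_eq_norm_sq_add_norm_sq_of_inner_eq_zero _ _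
    (inner_shiftEmbedding_dilResidual hA (shiftProj hA x) x)
  rw [dilResidual_apply, add_sub_cancel, LinearIsometry.norm_map, ← dilResidual_apply] at h
  linarith

theorem dilV_dilResidual (j : ι) (x : DilSpace hA) :
    dilV hA j (dilResidual hA x) = dilResidual hA (dilV hA j x) := by
  rw [dilResidual_apply, dilResidual_apply, map_sub, dilV_shiftEmbedding,
    adjoint_shiftEmbedding_dilV]

/-- The isometry `Δ ξ ↦ (I - P) ξ`, where `P` projects onto the row shift part, of the second
summand of the model space into the dilation space; it exists as `Δ² = I - M* M` is the compression
of `I - P` to `Γ ⊗ D_A`. -/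
def residualEmbedding : defectSpace (charFn hA).toCLM →ₗᵢ[ℂ] DilSpace hA :=
  extendIsometry (defectMap (charFn hA).toCLM) (denseRange_defectMap _)
    (dilResidual hA ∘L (dilInr hA).toContinuousLinearMap) fun ξ => by
      rw [← sq_eq_sq₀ (norm_nonneg _) (norm_nonneg _), norm_sq_defectMap (charFn hA).norm_le]
      change ‖dilResidual hA (dilInr hA ξ)‖ ^ 2 = ‖ξ‖ ^ 2 - ‖shiftProj hA (dilInr hA ξ)‖ ^ 2
      rw [norm_sq_dilResidual, LinearIsometry.norm_map]

theorem residualEmbedding_defectMap (ξ : Fock ι (DefSp hA)) :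
    residualEmbedding hA (defectMap (charFn hA).toCLM ξ) = dilResidual hA (dilInr hA ξ) :=
  extendIsometry_apply _ _ _ _ ξ

theorem inner_shiftEmbedding_residualEmbedding (η : Fock ι (DefSpStar hA))
    (d : defectSpace (charFn hA).toCLM) :
    ⟪shiftEmbedding hA η, residualEmbedding hA d⟫_ℂ = 0 :=
  (denseRange_defectMap (charFn hA).toCLM).induction_on d
    (isClosed_eq (by fun_prop) (by fun_prop)) fun ξ => by
      rw [residualEmbedding_defectMap, inner_shiftEmbedding_dilResidual]

/-- The isometry of the model space into the dilation space that identifies `Γ ⊗ D_{*,A}` with the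
row shift part and maps `Δ ξ` to the component of `ξ` orthogonal to that part. -/
def modelToDil : (charFn hA).ModelSpace →ₗᵢ[ℂ] DilSpace hA :=
  coprodIsometry (shiftEmbedding hA) (residualEmbedding hA)
    (inner_shiftEmbedding_residualEmbedding hA)

theorem modelToDil_apply (x : (charFn hA).ModelSpace) :
    modelToDil hA x = shiftEmbedding hA x.fst + residualEmbedding hA x.snd := rfl

theorem modelToDil_modelW (ξ : Fock ι (DefSp hA)) :
    modelToDil hA ((charFn hA).modelW ξ) = dilInr hA ξ := by
  change shiftEmbedding hA (shiftProj hA (dilInr hA ξ)) +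
    residualEmbedding hA (defectMap (charFn hA).toCLM ξ) = _
  rw [residualEmbedding_defectMap, dilResidual_apply, add_sub_cancel]

theorem residualEmbedding_residual (j : ι) (d : defectSpace (charFn hA).toCLM) :
    residualEmbedding hA ((charFn hA).residual j d) = dilV hA j (residualEmbedding hA d) :=
  (denseRange_defectMap (charFn hA).toCLM).induction_on d
    (isClosed_eq (by fun_prop) (by fun_prop)) fun ξ => by
      rw [ContractiveMultiAnalytic.residual_defectMap, residualEmbedding_defectMap,
        residualEmbedding_defectMap, dilV_dilResidual, dilV_dilInr]

theorem modelToDil_modelV (j : ι) (x : (charFn hA).ModelSpace) :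
    modelToDil hA ((charFn hA).modelV j x) = dilV hA j (modelToDil hA x) := by
  rw [modelToDil_apply, modelToDil_apply, map_add, dilV_shiftEmbedding,
    ← residualEmbedding_residual]
  rfl

/-- In the completely non-coisometric case the model space is all of the dilation space: a vector
orthogonal to the row shift part and to the `(I - P) ξ` is orthogonal to `Γ ⊗ D_A`, hence lies in
`H`, where no nonzero vector is orthogonal to the row shift part. -/
theorem modelToDil_surjective (hcnc : IsCompletelyNonCoisometric A) :
    Function.Surjective (modelToDil hA) := by
  refine surjective_of_orthogonal_eq_zero _ fun y hy => ?_
  have hS : shiftProj hA y = 0 := ext_inner_left ℂ fun η => by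
    have := hy (WithLp.toLp 2 (η, 0))
    rw [modelToDil_apply] at this
    change ⟪shiftEmbedding hA η + residualEmbedding hA 0, y⟫_ℂ = 0 at this
    rw [map_zero, add_zero] at this
    rw [← inner_conj_symm, inner_shiftProj_left, inner_conj_symm, this, inner_zero_right]
  have hR : y.snd = 0 := ext_inner_left ℂ fun ξ => by
    have := hy ((charFn hA).modelW ξ)
    rw [modelToDil_modelW, dilSpace_eq hA y, inner_add_right, LinearIsometry.inner_map_map,
      ← inner_conj_symm, inner_dilInl_dilInr, map_zero, zero_add] at this
    rw [this, inner_zero_right]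
  have hy' : y = dilInl hA y.fst := by
    conv_lhs => rw [dilSpace_eq hA y, hR, map_zero, add_zero]
  rw [hy'] at hS
  rw [hy', eq_zero_of_shiftProj_dilInl hA hcnc hS, map_zero]

theorem mem_modelHA_iff (x : (charFn hA).ModelSpace) :
    x ∈ (charFn hA).modelHA ↔ ∃ h, dilInl hA h = modelToDil hA x := by
  have key : ∀ ξ, ⟪(charFn hA).modelW ξ, x⟫_ℂ = ⟪ξ, (modelToDil hA x).snd⟫_ℂ := fun ξ => by
    rw [← (modelToDil hA).inner_map_map, modelToDil_modelW]
    conv_lhs => rw [dilSpace_eq hA (modelToDil hA x), inner_add_right, ← inner_conj_symm,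
      inner_dilInl_dilInr, map_zero, zero_add, LinearIsometry.inner_map_map]
  constructor
  · intro hx
    have h0 : (modelToDil hA x).snd = 0 := ext_inner_left ℂ fun ξ => by
      rw [← key, inner_zero_right]
      exact (Submodule.mem_orthogonal _ _).1 hx _ ⟨ξ, rfl⟩
    refine ⟨(modelToDil hA x).fst, ?_⟩
    conv_rhs => rw [dilSpace_eq hA (modelToDil hA x), h0, map_zero, add_zero]
  · rintro ⟨h, hh⟩
    rw [Submodule.mem_orthogonal]
    rintro _ ⟨ξ, rfl⟩
    refine (key ξ).trans ?_
    rw [← hh]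
    exact inner_zero_right _

/-- Minimality carries over from the dilation space, where it holds without any assumption. -/
theorem charFn_isMinimalIsometricDilation (hcnc : IsCompletelyNonCoisometric A) :
    IsMinimalIsometricDilation (charFn hA).modelA (charFn hA).modelHA.subtypeₗᵢ
      (charFn hA).modelV := by
  refine ⟨⟨⟨fun i x => ?_, fun i j hij x y => ?_⟩,
    word_eq_compression (charFn hA).adjoint_subtype_modelV⟩, fun N hN hH hV => ?_⟩
  · exact LinearIsometry.norm_map _ x
  · rw [← (modelToDil hA).inner_map_map, modelToDil_modelV, modelToDil_modelV,
      inner_dilV_of_ne hA hij]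
  · let e := LinearIsometryEquiv.ofSurjective (modelToDil hA) (modelToDil_surjective hA hcnc)
    have he : ∀ x, modelToDil hA (e.symm x) = x := e.apply_symm_apply
    have hN' : N.comap e.symm.toLinearEquiv.toLinearMap = ⊤ := by
      refine eq_top_of_dilV_invariant hA (hN.preimage e.symm.continuous)
        (fun h => hH ⟨e.symm (dilInl hA h), (mem_modelHA_iff hA _).2 ⟨h, (he _).symm⟩⟩)
        fun j x hx => ?_
      have : e.symm (dilV hA j x) = (charFn hA).modelV j (e.symm x) :=
        (modelToDil hA).injective (by rw [he, modelToDil_modelV, he])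
      change e.symm (dilV hA j x) ∈ N
      rw [this]
      exact hV j _ hx
    rw [eq_top_iff]
    intro x _
    have : e x ∈ N.comap e.symm.toLinearEquiv.toLinearMap := hN' ▸ Submodule.mem_top
    change e.symm (e x) ∈ N at this
    rwa [e.symm_apply_apply] at this

/-- `H`, as a subspace of the dilation space, corresponds to `H_A`. -/
theorem exists_isometry_modelHA (hcnc : IsCompletelyNonCoisometric A) :
    ∃ U : H →ₗᵢ[ℂ] (charFn hA).modelHA, ∀ h, modelToDil hA (U h) = dilInl hA h := by
  let e := LinearIsometryEquiv.ofSurjective (modelToDil hA) (modelToDil_surjective hA hcnc)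
  have he : ∀ x, modelToDil hA (e.symm x) = x := e.apply_symm_apply
  clear_value e
  let L : H →ₗᵢ[ℂ] (charFn hA).ModelSpace := e.symm.toLinearIsometry.comp (dilInl hA)
  have hL : ∀ h, modelToDil hA (L h) = dilInl hA h := fun h => he _
  clear_value L
  refine ⟨⟨L.toLinearMap.codRestrict (charFn hA).modelHA fun h =>
    (mem_modelHA_iff hA _).2 ⟨h, (hL h).symm⟩, fun h => L.norm_map h⟩, hL⟩

/-- The isometry of `H` onto `H_A` intertwines, since `V_i h - A_i h` lies in `Γ ⊗ D_A`, which
corresponds to the complement of `H_A`. -/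
theorem exists_unitary_modelA (hcnc : IsCompletelyNonCoisometric A) :
    ∃ U : H ≃ₗᵢ[ℂ] (charFn hA).modelHA, ∀ i h, U (A i h) = (charFn hA).modelA i (U h) := by
  obtain ⟨U, hU⟩ := exists_isometry_modelHA hA hcnc
  have hsurj : Function.Surjective U := fun x => by
    obtain ⟨h, hh⟩ := (mem_modelHA_iff hA x).1 x.2
    exact ⟨h, Subtype.ext ((modelToDil hA).injective ((hU h).trans hh))⟩
  have hint : ∀ i h, U (A i h) = (charFn hA).modelA i (U h) := fun i h => by
    refine ((charFn hA).modelA_eq_of_modelV_eq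
      (ξ := single [] (defectMap hA.row (single i h))) ((modelToDil hA).injective ?_)).symm
    rw [modelToDil_modelV, map_add, hU, hU, modelToDil_modelW, dilV_dilInl, dilRow_eq,
      hA.row_single]
  exact ⟨LinearIsometryEquiv.ofSurjective U hsurj, hint⟩

end Model

end RowModel

end

open RowModel in
theorem corollary4p4 {ι : Type*} [Countable ι] {H : Type*} [NormedAddCommGroup H]
    [InnerProductSpace ℂ H] [CompleteSpace H] (A : ι → H →L[ℂ] H) (hA : IsRowContraction A)
    (hcnc : IsCompletelyNonCoisometric A) :
    NoConstantDirections (charFn hA).symbol ∧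
    Function.Injective (charFn hA).symbol ∧
    IsMinimalIsometricDilation (charFn hA).modelA (charFn hA).modelHA.subtypeₗᵢ
      (charFn hA).modelV ∧
    ∃ U : H ≃ₗᵢ[ℂ] (charFn hA).modelHA, ∀ i h, U (A i h) = (charFn hA).modelA i (U h) := by
  exact ⟨charFn_noConstantDirections hA hcnc, charFn_symbol_injective hA hcnc,
    charFn_isMinimalIsometricDilation hA hcnc, exists_unitary_modelA hA hcnc⟩
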